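/- Let $N\ge 1$, $h\in\mathbb C$, $\boldsymbol s\in\mathbb C^N$, $\boldsymbol S=\operatorname{diag}(\boldsymbol s)$, $\sigma_v>0$. On a probability space let $\boldsymbol x_k\sim\mathcal{CN}(\boldsymbol 0,\boldsymbol R_x)$, $\boldsymbol f_k\sim\mathcal{CN}(\boldsymbol 0,\boldsymbol R_f)$, $\boldsymbol v_k\sim\mathcal{CN}(\boldsymbol 0,\sigma_v^2\boldsymbol I_N)$ be $N$-dimensional complex circularly symmetric Gaussian vectors (with possibly singular covariances $\boldsymbol R_x=\mathbb E[\boldsymbol x_k\boldsymbol x_k^H]$ and $\boldsymbol R_f=\mathbb E[\boldsymbol f_k\boldsymbol f_k^H]$) and let $\zeta_k$ be a $\{0,1\}$-valued random variable with $\Pr(\zeta_k=1)=\alpha$, such that $\boldsymbol x_k,\zeta_k,\boldsymbol f_k,\boldsymbol v_k$ are mutually independent. Let $$\boldsymbol z_k=h\boldsymbol x_k+\zeta_k\boldsymbol S\boldsymbol f_k+\boldsymbol v_k .$$ For $\beta\in[0,1]$ define the compound rate $$\mathrm{CR}=\frac{\beta}{N}\log_2\det\Big(\boldsymbol I_N+\frac{|h|^2}{\sigma_v^2}\boldsymbol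 R_x\Big(\boldsymbol I_N+\frac1{\sigma_v^2}\boldsymbol S\boldsymbol R_f\boldsymbol S^H\Big)^{-1}\Big)+\frac{1-\beta}{N}\log_2\det\Big(\boldsymbol I_N+\frac{|h|^2}{\sigma_v^2}\boldsymbol R_x\Big).$$ Let $I(\boldsymbol x_k;\boldsymbol z_k)$ denote the mutual information, and let $I(\boldsymbol x_k;\boldsymbol z_k\mid\zeta_k)=\sum_{c\in\{0,1\}}\Pr(\zeta_k=c)\,I(\boldsymbol x_k;\boldsymbol z_k\mid\zeta_k=c)$ denote the conditional mutual information, both in bits. If $\beta=\alpha$, then both are finite, $$I(\boldsymbol x_k;\boldsymbol z_k\mid\zeta_k)=N\cdot\mathrm{CR},\qquad\text{and}\qquad \mathrm{CR}-\frac1N\le\frac1N I(\boldsymbol x_k;\boldsymbol z_k)\le\mathrm{CR}.$$ -/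

import Mathlib

open MeasureTheory ProbabilityTheory
open scoped ENNReal Matrix

/-- Mutual information `I(X; Y)` in bits, under the law `P`: the Kullback-Leibler divergence of the
joint law from the product of the marginals (in nats), divided by `log 2`. The value may be `∞`. -/
noncomputable def mutualInfo {Ω A B : Type*} [MeasurableSpace Ω] [MeasurableSpace A]
    [MeasurableSpace B] (P : Measure Ω) (X : Ω → A) (Y : Ω → B) : ℝ≥0∞ :=
  InformationTheory.klDiv (P.map (fun ω => (X ω, Y ω))) ((P.map X).prod (P.map Y)) /
    ENNReal.ofReal (Real.log 2)

/-- Conditional mutual information `I(X; Y | Z)` in bits, for a random variable `Z` with finitely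
many values: the average over `c`, with weights `P(Z = c)`, of the mutual information of `X` and
`Y` under the conditional law given `Z = c`. -/
noncomputable def condMutualInfo {Ω A B C : Type*} [MeasurableSpace Ω] [MeasurableSpace A]
    [MeasurableSpace B] [Fintype C] (P : Measure Ω) (X : Ω → A) (Y : Ω → B) (Z : Ω → C) : ℝ≥0∞ :=
  ∑ c : C, P (Z ⁻¹' {c}) * mutualInfo (ProbabilityTheory.cond P (Z ⁻¹' {c})) X Y

/-- The random vector `X` has the complex circularly symmetric Gaussian law `CN(0, R)`: its real
and imaginary parts are jointly Gaussian (every real-linear functional of `X` is Gaussian), its mean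
is zero, its covariance `E[X Xᴴ]` is `R`, and its pseudo-covariance `E[X Xᵀ]` vanishes. -/
structure IsCircularGaussian {Ω : Type*} [MeasurableSpace Ω] {N : ℕ} (P : Measure Ω)
    (X : Ω → Fin N → ℂ) (R : Matrix (Fin N) (Fin N) ℂ) : Prop where
  measurable : Measurable X
  gaussian : HasGaussianLaw X P
  mean : ∀ i, ∫ ω, X ω i ∂P = 0
  cov : ∀ i j, ∫ ω, X ω i * star (X ω j) ∂P = R i j
  pseudoCov : ∀ i j, ∫ ω, X ω i * X ω j ∂P = 0

/-- The channel output: `h x + S f + v` with `S = diag(s)` if interference is present (`ζ = true`),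
and `h x + v` otherwise. -/
noncomputable def channelOutput {Ω : Type*} {N : ℕ} (h : ℂ) (s : Fin N → ℂ)
    (x f v : Ω → Fin N → ℂ) (ζ : Ω → Bool) : Ω → Fin N → ℂ :=
  fun ω => h • x ω + (if ζ ω = true then Matrix.diagonal s *ᵥ f ω else 0) + v ω

/-- The matrix `I + (|h|² / σ²) Rx`. -/
noncomputable def cleanMatrix {N : ℕ} (h : ℂ) (σ : ℝ) (Rx : Matrix (Fin N) (Fin N) ℂ) :
    Matrix (Fin N) (Fin N) ℂ :=
  1 + ((‖h‖ ^ 2 / σ ^ 2 : ℝ) : ℂ) • Rx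

/-- The normalized interference-plus-noise covariance `I + (1 / σ²) S Rf Sᴴ`, `S = diag(s)`. -/
noncomputable def interferenceMatrix {N : ℕ} (σ : ℝ) (s : Fin N → ℂ)
    (Rf : Matrix (Fin N) (Fin N) ℂ) : Matrix (Fin N) (Fin N) ℂ :=
  1 + ((1 / σ ^ 2 : ℝ) : ℂ) • (Matrix.diagonal s * Rf * (Matrix.diagonal s)ᴴ)

/-- The matrix `I + (|h|² / σ²) Rx (I + (1 / σ²) S Rf Sᴴ)⁻¹`. -/
noncomputable def interferedMatrix {N : ℕ} (h : ℂ) (σ : ℝ) (s : Fin N → ℂ)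
    (Rx Rf : Matrix (Fin N) (Fin N) ℂ) : Matrix (Fin N) (Fin N) ℂ :=
  1 + ((‖h‖ ^ 2 / σ ^ 2 : ℝ) : ℂ) • (Rx * (interferenceMatrix σ s Rf)⁻¹)

/-- The rate without interference, `(1/N) log₂ det (I + (|h|² / σ²) Rx)`. The determinant is a
positive real number, see `det_cleanMatrix_pos`. -/
noncomputable def rateClean {N : ℕ} (h : ℂ) (σ : ℝ) (Rx : Matrix (Fin N) (Fin N) ℂ) : ℝ :=
  1 / (N : ℝ) * Real.logb 2 (cleanMatrix h σ Rx).det.re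

/-- The rate with interference, `(1/N) log₂ det (I + (|h|² / σ²) Rx (I + (1 / σ²) S Rf Sᴴ)⁻¹)`.
The determinant is a positive real number, see `det_interferedMatrix_pos`. -/
noncomputable def rateInterfered {N : ℕ} (h : ℂ) (σ : ℝ) (s : Fin N → ℂ)
    (Rx Rf : Matrix (Fin N) (Fin N) ℂ) : ℝ :=
  1 / (N : ℝ) * Real.logb 2 (interferedMatrix h σ s Rx Rf).det.re

/-- The compound rate: the convex combination of the two rates with weight `β`. -/
noncomputable def compoundRate {N : ℕ} (β : ℝ) (h : ℂ) (σ : ℝ) (s : Fin N → ℂ)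
    (Rx Rf : Matrix (Fin N) (Fin N) ℂ) : ℝ :=
  β * rateInterfered h σ s Rx Rf + (1 - β) * rateClean h σ Rx

open scoped ComplexOrder in
theorem cleanMatrix_posDef {N : ℕ} (h : ℂ) (σ : ℝ) {Rx : Matrix (Fin N) (Fin N) ℂ}
    (hRx : Rx.PosSemidef) : (cleanMatrix h σ Rx).PosDef := by
  refine Matrix.PosDef.one.add_posSemidef (hRx.smul ?_)
  exact_mod_cast (by positivity : (0 : ℝ) ≤ ‖h‖ ^ 2 / σ ^ 2)

open scoped ComplexOrder in
theorem det_cleanMatrix_pos {N : ℕ} (h : ℂ) (σ : ℝ) {Rx : Matrix (Fin N) (Fin N) ℂ}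
    (hRx : Rx.PosSemidef) : 0 < (cleanMatrix h σ Rx).det :=
  (cleanMatrix_posDef h σ hRx).det_pos

open scoped ComplexOrder in
theorem interferenceMatrix_posDef {N : ℕ} (σ : ℝ) (s : Fin N → ℂ)
    {Rf : Matrix (Fin N) (Fin N) ℂ} (hRf : Rf.PosSemidef) :
    (interferenceMatrix σ s Rf).PosDef := by
  refine Matrix.PosDef.one.add_posSemidef
    ((hRf.mul_mul_conjTranspose_same (Matrix.diagonal s)).smul ?_)
  exact_mod_cast (by positivity : (0 : ℝ) ≤ 1 / σ ^ 2)

open scoped ComplexOrder in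
theorem det_interferedMatrix_pos {N : ℕ} (h : ℂ) (σ : ℝ) (s : Fin N → ℂ)
    {Rx Rf : Matrix (Fin N) (Fin N) ℂ} (hRx : Rx.PosSemidef) (hRf : Rf.PosSemidef) :
    0 < (interferedMatrix h σ s Rx Rf).det := by
  have hA := interferenceMatrix_posDef σ s hRf
  have hB : (interferenceMatrix σ s Rf + ((‖h‖ ^ 2 / σ ^ 2 : ℝ) : ℂ) • Rx).PosDef := by
    refine hA.add_posSemidef (hRx.smul ?_)
    exact_mod_cast (by positivity : (0 : ℝ) ≤ ‖h‖ ^ 2 / σ ^ 2)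
  have hu : IsUnit (interferenceMatrix σ s Rf).det := hA.det_pos.ne'.isUnit
  have key : interferedMatrix h σ s Rx Rf * interferenceMatrix σ s Rf =
      interferenceMatrix σ s Rf + ((‖h‖ ^ 2 / σ ^ 2 : ℝ) : ℂ) • Rx := by
    rw [interferedMatrix, add_mul, one_mul, Matrix.smul_mul, Matrix.mul_assoc,
      Matrix.nonsing_inv_mul _ hu, Matrix.mul_one]
  have hdet := congrArg Matrix.det key
  rw [Matrix.det_mul] at hdet
  have h3 := hB.det_pos
  rw [← hdet] at h3
  exact (pos_iff_pos_of_mul_pos h3).mpr hA.det_pos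

/-! ### Circular Gaussian vectors and their real coordinates. -/

section CircularGaussian

variable {Ω : Type*} [MeasurableSpace Ω] {P : Measure Ω} {N : ℕ} {X Y : Ω → Fin N → ℂ}
  {R R' : Matrix (Fin N) (Fin N) ℂ}

/-! In each state c the channel is additive, z = h x + n, with Gaussian noise n independent of x.
Relative to P_x ⊗ P_z, the joint law of (x, z) has density exp(a(z - h x) - b(z)), where exp a and
exp b are the densities of n and z (`map_additiveChannel`). The mutual information in nats is
therefore E a(n) - E b(z). The input x needs no density, so its covariance may be singular; the
white noise makes the covariances of n and z invertible. A Gaussian vector of covariance W has mean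
log-density -log det W - N against a suitably normalized Haar measure (`exists_logDensity`), so the
difference is a log-ratio of determinants, which is the rate of that state. Since ζ is independent
of (x, f, v), averaging over the states gives the conditional information.

When the state is unknown, the noise and output densities are mixtures exp p = Σ w_c exp a_c and exp
q = Σ w_c exp b_c, and the same formula gives E p(n) - E q(z). The upper bound is the joint
convexity of relative entropy (`integral_logDensity_mixture_le`). For the lower bound, Gibbs'
inequality gives E q ≤ E b_c in state c, while p ≥ log w_c + a_c pointwise; the loss is thus at most
the entropy of ζ, hence at most one bit (`mul_log_add_mul_log_ge`). These bounds are combined in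
`mutualInfo_mixtureChannel`. All expectations are finite because the log-densities are bounded above
and have a quadratic lower bound, while the vectors are square integrable. -/

theorem IsCircularGaussian.memLp_apply (hX : IsCircularGaussian P X R) (i : Fin N) :
    MemLp (fun ω => X ω i) 2 P :=
  hX.gaussian.memLp_two.eval i

theorem IsCircularGaussian.integrable_apply (hX : IsCircularGaussian P X R) (i : Fin N) :
    Integrable (fun ω => X ω i) P :=
  hX.gaussian.integrable.eval i

theorem IsCircularGaussian.integrable_mul (hX : IsCircularGaussian P X R) (i j : Fin N) :
    Integrable (fun ω => X ω i * X ω j) P :=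
  (hX.memLp_apply i).integrable_mul (hX.memLp_apply j)

theorem IsCircularGaussian.integrable_mul_star (hX : IsCircularGaussian P X R) (i j : Fin N) :
    Integrable (fun ω => X ω i * star (X ω j)) P :=
  (hX.memLp_apply i).integrable_mul (hX.memLp_apply j).star

/-- The image of a circular Gaussian vector under a linear map is circular Gaussian. -/
theorem IsCircularGaussian.mulVec (hX : IsCircularGaussian P X R)
    {m : ℕ} (M : Matrix (Fin m) (Fin N) ℂ) :
    IsCircularGaussian P (fun ω => M *ᵥ X ω) (M * R * Mᴴ) where
  measurable := by
    have := hX.measurable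
    unfold Matrix.mulVec dotProduct
    fun_prop
  gaussian := hX.gaussian.map_fun
    (LinearMap.toContinuousLinearMap ((Matrix.mulVecLin M).restrictScalars ℝ))
  mean i := by
    simp only [Matrix.mulVec, dotProduct]
    rw [integral_finsetSum _ fun j _ => (hX.integrable_apply j).const_mul _]
    simp [integral_const_mul, hX.mean]
  cov i j := by
    simp only [Matrix.mulVec, dotProduct, star_sum, star_mul', Finset.sum_mul_sum]
    have key : ∀ k l, (fun ω => M i k * X ω k * (star (M j l) * star (X ω l))) =
        fun ω => (M i k * star (M j l)) * (X ω k * star (X ω l)) := fun k l => by ext; ring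
    have hint : ∀ k l, Integrable (fun ω => M i k * X ω k * (star (M j l) * star (X ω l))) P :=
      fun k l => by rw [key]; exact (hX.integrable_mul_star k l).const_mul _
    rw [integral_finsetSum _ fun k _ => integrable_finsetSum _ fun l _ => hint k l]
    simp only [Matrix.mul_apply, Finset.sum_mul, Matrix.conjTranspose_apply]
    rw [Finset.sum_comm]
    refine Finset.sum_congr rfl fun k _ => ?_
    rw [integral_finsetSum _ fun l _ => hint k l]
    refine Finset.sum_congr rfl fun l _ => ?_
    rw [key, integral_const_mul, hX.cov]
    ring
  pseudoCov i j := by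
    simp only [Matrix.mulVec, dotProduct, Finset.sum_mul_sum]
    have key : ∀ k l, (fun ω => M i k * X ω k * (M j l * X ω l)) =
        fun ω => (M i k * M j l) * (X ω k * X ω l) := fun k l => by ext; ring
    rw [integral_finsetSum]
    · refine Finset.sum_eq_zero fun k _ => ?_
      rw [integral_finsetSum]
      · refine Finset.sum_eq_zero fun l _ => ?_
        rw [key, integral_const_mul, hX.pseudoCov, mul_zero]
      · intro l _
        rw [key]
        exact (hX.integrable_mul k l).const_mul _
    · intro k _
      refine integrable_finsetSum _ fun l _ => ?_
      rw [key]
      exact (hX.integrable_mul k l).const_mul _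

/-- The sum of independent circular Gaussian vectors is circular Gaussian. -/
theorem IsCircularGaussian.add (hX : IsCircularGaussian P X R) (hY : IsCircularGaussian P Y R')
    (hXY : IndepFun X Y P) : IsCircularGaussian P (fun ω => X ω + Y ω) (R + R') where
  measurable := hX.measurable.add hY.measurable
  gaussian := (hXY.hasGaussianLaw hX.gaussian hY.gaussian).fun_add
  mean i := by
    simp only [Pi.add_apply]
    rw [integral_add (hX.integrable_apply i) (hY.integrable_apply i), hX.mean, hY.mean, add_zero]
  cov i j := by
    have h1 : ∫ ω, X ω i * star (Y ω j) ∂P = 0 := by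
      have h : IndepFun (fun ω => X ω i) (fun ω => star (Y ω j)) P :=
        hXY.comp (φ := fun u : Fin N → ℂ => u i) (ψ := fun u : Fin N → ℂ => star (u j)) (by fun_prop)
          (Continuous.measurable (by fun_prop))
      rw [h.integral_fun_mul_eq_mul_integral (hX.integrable_apply i).1
        (hY.memLp_apply j).star.1, hX.mean, zero_mul]
    have h2 : ∫ ω, Y ω i * star (X ω j) ∂P = 0 := by
      have h : IndepFun (fun ω => Y ω i) (fun ω => star (X ω j)) P :=
        hXY.symm.comp (φ := fun u : Fin N → ℂ => u i) (ψ := fun u : Fin N → ℂ => star (u j))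
          (by fun_prop)
          (Continuous.measurable (by fun_prop))
      rw [h.integral_fun_mul_eq_mul_integral (hY.integrable_apply i).1
        (hX.memLp_apply j).star.1, hY.mean, zero_mul]
    have i1 : Integrable (fun ω => X ω i * star (Y ω j)) P :=
      (hX.memLp_apply i).integrable_mul (hY.memLp_apply j).star
    have i2 : Integrable (fun ω => Y ω i * star (X ω j)) P :=
      (hY.memLp_apply i).integrable_mul (hX.memLp_apply j).star
    have e : (fun ω => (X ω + Y ω) i * star ((X ω + Y ω) j)) = fun ω =>
        (X ω i * star (X ω j) + X ω i * star (Y ω j)) +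
          (Y ω i * star (X ω j) + Y ω i * star (Y ω j)) := by
      ext ω; simp only [Pi.add_apply, star_add]; ring
    rw [e, integral_add (by exact (hX.integrable_mul_star i j).add i1)
      (by exact i2.add (hY.integrable_mul_star i j)), integral_add (hX.integrable_mul_star i j) i1,
      integral_add i2 (hY.integrable_mul_star i j), hX.cov, hY.cov, h1, h2]
    simp
  pseudoCov i j := by
    have h1 : ∀ i j, ∫ ω, X ω i * Y ω j ∂P = 0 := by
      intro i j
      have h : IndepFun (fun ω => X ω i) (fun ω => Y ω j) P :=
        hXY.comp (φ := fun u : Fin N → ℂ => u i) (ψ := fun u : Fin N → ℂ => u j) (by fun_prop) (by fun_prop)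
      rw [h.integral_fun_mul_eq_mul_integral (hX.integrable_apply i).1
        (hY.memLp_apply j).1, hX.mean, zero_mul]
    have i1 : Integrable (fun ω => X ω i * Y ω j) P :=
      (hX.memLp_apply i).integrable_mul (hY.memLp_apply j)
    have i2 : Integrable (fun ω => X ω j * Y ω i) P :=
      (hX.memLp_apply j).integrable_mul (hY.memLp_apply i)
    have e : (fun ω => (X ω + Y ω) i * ((X ω + Y ω) j)) = fun ω =>
        (X ω i * (X ω j) + X ω i * (Y ω j)) +
          (X ω j * (Y ω i) + Y ω i * (Y ω j)) := by
      ext ω; simp only [Pi.add_apply]; ring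
    rw [e, integral_add (by exact (hX.integrable_mul i j).add i1)
      (by exact i2.add (hY.integrable_mul i j)), integral_add (hX.integrable_mul i j) i1,
      integral_add i2 (hY.integrable_mul i j), hX.pseudoCov, hY.pseudoCov, h1, h1]
    simp

-- The quadratic form of `R` at `a` is the variance E|aᴴX|² of a scalar linear image of `X`.
open scoped ComplexOrder in
theorem IsCircularGaussian.posSemidef (hX : IsCircularGaussian P X R) : R.PosSemidef := by
  refine Matrix.PosSemidef.of_dotProduct_mulVec_nonneg ?_ fun a => ?_
  · ext i j
    rw [Matrix.conjTranspose_apply, ← hX.cov, ← hX.cov, RCLike.star_def, ← integral_conj]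
    simp [mul_comm]
  · have h := (hX.mulVec (Matrix.of fun _ : Fin 1 => star a)).cov 0 0
    have e : ((Matrix.of fun _ : Fin 1 => star a) * R * (Matrix.of fun _ : Fin 1 => star a)ᴴ) 0 0
        = star a ⬝ᵥ R *ᵥ a := by
      rw [Matrix.mul_assoc]
      simp [Matrix.mul_apply, dotProduct, Matrix.mulVec]
    rw [← e, ← h]
    refine integral_nonneg fun ω => ?_
    exact mul_star_self_nonneg (_ : ℂ)

/-- The real and imaginary parts of a complex vector, listed as real coordinates. -/
noncomputable def realCoords (N : ℕ) : (Fin N → ℂ) ≃L[ℝ] (Fin N × Bool → ℝ) :=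
  LinearEquiv.toContinuousLinearEquiv
    { toFun := fun u p => if p.2 then (u p.1).im else (u p.1).re
      invFun := fun y i => ⟨y (i, false), y (i, true)⟩
      map_add' := fun u v => by ext ⟨i, b⟩; cases b <;> simp
      map_smul' := fun c u => by ext ⟨i, b⟩; cases b <;> simp
      left_inv := fun u => by ext i; all_goals simp
      right_inv := fun y => by ext ⟨i, b⟩; cases b <;> simp }

theorem realCoords_apply (u : Fin N → ℂ) (p : Fin N × Bool) :
    realCoords N u p = if p.2 then (u p.1).im else (u p.1).re := rfl

theorem sum_sq_realCoords (u : Fin N → ℂ) :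
    ∑ p, realCoords N u p ^ 2 = ∑ i, Complex.normSq (u i) := by
  rw [Fintype.sum_prod_type]
  refine Finset.sum_congr rfl fun i _ => ?_
  simp [realCoords_apply, Complex.normSq_apply]
  ring

/-- The real and imaginary parts of the covariance and of the vanishing pseudo-covariance are four
linear equations in the four real second moments of the pair. -/
theorem IsCircularGaussian.integral_re_im (hX : IsCircularGaussian P X R) (i j : Fin N) :
    ∫ ω, (X ω i).re * (X ω j).re ∂P = (R i j).re / 2 ∧
    ∫ ω, (X ω i).im * (X ω j).im ∂P = (R i j).re / 2 ∧
    ∫ ω, (X ω i).im * (X ω j).re ∂P = (R i j).im / 2 := by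
  have hm := hX.memLp_apply
  have rr : Integrable (fun ω => RCLike.re (X ω i) * RCLike.re (X ω j)) P :=
    (hm i).re.integrable_mul (hm j).re
  have ii : Integrable (fun ω => RCLike.im (X ω i) * RCLike.im (X ω j)) P :=
    (hm i).im.integrable_mul (hm j).im
  have ri : Integrable (fun ω => RCLike.re (X ω i) * RCLike.im (X ω j)) P :=
    (hm i).re.integrable_mul (hm j).im
  have ir : Integrable (fun ω => RCLike.im (X ω i) * RCLike.re (X ω j)) P :=
    (hm i).im.integrable_mul (hm j).re
  have c := hX.cov i j
  have p := hX.pseudoCov i j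
  have c1 := congrArg Complex.re c
  have c2 := congrArg Complex.im c
  have p1 := congrArg Complex.re p
  have p2 := congrArg Complex.im p
  have ic := hX.integrable_mul_star i j
  have ip := hX.integrable_mul i j
  rw [← RCLike.re_eq_complex_re, ← integral_re ic] at c1
  rw [← RCLike.im_eq_complex_im, ← integral_im ic] at c2
  rw [← RCLike.re_eq_complex_re, ← integral_re ip] at p1
  rw [← RCLike.im_eq_complex_im, ← integral_im ip] at p2
  simp only [RCLike.star_def, RCLike.mul_re, RCLike.mul_im, RCLike.conj_re, RCLike.conj_im,
    map_zero, mul_neg, sub_neg_eq_add] at c1 c2 p1 p2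
  rw [integral_add rr ii] at c1
  rw [integral_sub rr ii] at p1
  rw [integral_add ri ir] at p2
  rw [integral_add ri.fun_neg ir, integral_neg] at c2
  simp only [RCLike.re_eq_complex_re, RCLike.im_eq_complex_im] at c1 c2 p1 p2
  refine ⟨?_, ?_, ?_⟩ <;> linarith

theorem IsCircularGaussian.hasGaussianLaw_realCoords (hX : IsCircularGaussian P X R) :
    HasGaussianLaw (fun ω => realCoords N (X ω)) P :=
  hX.gaussian.map_equiv_fun (realCoords N)

theorem IsCircularGaussian.integral_realCoords (hX : IsCircularGaussian P X R)
    (p : Fin N × Bool) : ∫ ω, realCoords N (X ω) p ∂P = 0 := by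
  have h := hX.mean p.1
  have hi := hX.integrable_apply p.1
  obtain ⟨i, b⟩ := p
  cases b
  · have := congrArg Complex.re h
    rwa [← RCLike.re_eq_complex_re, ← integral_re hi] at this
  · have := congrArg Complex.im h
    rwa [← RCLike.im_eq_complex_im, ← integral_im hi] at this

/-- Unit complex variance splits equally between the real and imaginary parts, whence the 1/2. -/
theorem IsCircularGaussian.covariance_realCoords [IsProbabilityMeasure P]
    (hX : IsCircularGaussian P X 1) (p q : Fin N × Bool) :
    cov[fun ω => realCoords N (X ω) p, fun ω => realCoords N (X ω) q; P] =
      if p = q then 1 / 2 else 0 := by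
  have hm := hX.hasGaussianLaw_realCoords.memLp_two
  rw [covariance_eq_sub (hm.eval p) (hm.eval q), hX.integral_realCoords, zero_mul, sub_zero]
  obtain ⟨i, b⟩ := p
  obtain ⟨j, c⟩ := q
  have h1 := hX.integral_re_im i j
  have h2 : ∫ ω, (X ω i).re * (X ω j).im ∂P = 0 := by
    simp_rw [mul_comm (X _ i).re]
    rw [(hX.integral_re_im j i).2.2, Matrix.one_apply]
    split_ifs <;> simp
  cases b <;> cases c <;> simp only [Pi.mul_apply, realCoords_apply] <;>
    by_cases hij : i = j <;> simp_all [Matrix.one_apply]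

/-- The real coordinates of a white circular Gaussian vector are independent. -/
theorem IsCircularGaussian.iIndepFun_realCoords [IsProbabilityMeasure P]
    (hX : IsCircularGaussian P X 1) :
    iIndepFun (fun p ω => realCoords N (X ω) p) P :=
  hX.hasGaussianLaw_realCoords.iIndepFun_of_covariance_eq_zero fun p q hpq => by
    rw [hX.covariance_realCoords, if_neg hpq]

theorem IsCircularGaussian.map_realCoords_apply [IsProbabilityMeasure P]
    (hX : IsCircularGaussian P X 1) (p : Fin N × Bool) :
    P.map (fun ω => realCoords N (X ω) p) = gaussianReal 0 (1 / 2) := by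
  have hp := hX.hasGaussianLaw_realCoords.eval p
  rw [hp.map_eq_gaussianReal, hX.integral_realCoords, ← covariance_self hp.aemeasurable,
    hX.covariance_realCoords, if_pos rfl]
  congr 1
  ext
  simp

theorem IsCircularGaussian.map_realCoords [IsProbabilityMeasure P]
    (hX : IsCircularGaussian P X 1) :
    P.map (fun ω => realCoords N (X ω)) = Measure.pi fun _ => gaussianReal 0 (1 / 2) := by
  have h := (iIndepFun_iff_map_fun_eq_pi_map fun p =>
    (hX.hasGaussianLaw_realCoords.eval p).aemeasurable).1 hX.iIndepFun_realCoords
  simp only [hX.map_realCoords_apply] at h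
  exact h

end CircularGaussian

/-! ### Densities of Gaussian vectors with invertible covariance. -/

section Density

/-- Pushing forward a density which factors through the map. -/
theorem map_withDensity_comp {A B : Type*} [MeasurableSpace A] [MeasurableSpace B]
    (μ : Measure A) {T : A → B} (hT : Measurable T) {f : B → ℝ≥0∞} (hf : Measurable f) :
    (μ.withDensity (f ∘ T)).map T = (μ.map T).withDensity f := by
  ext s hs
  rw [Measure.map_apply hT hs, withDensity_apply _ (hT hs), withDensity_apply _ hs,
    setLIntegral_map hs hf hT]
  rfl

/-- A product of measures with densities is the product measure with the product density. -/
theorem pi_withDensity_ofReal {ι : Type*} [Fintype ι] (ρ : Measure ℝ) [SigmaFinite ρ]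
    {g : ℝ → ℝ} (hg0 : ∀ t, 0 ≤ g t) (hgi : Integrable g ρ) :
    Measure.pi (fun _ : ι => ρ.withDensity fun t => ENNReal.ofReal (g t)) =
      (Measure.pi fun _ : ι => ρ).withDensity fun y => ENNReal.ofReal (∏ i, g (y i)) := by
  have : IsFiniteMeasure (ρ.withDensity fun t => ENNReal.ofReal (g t)) :=
    isFiniteMeasure_withDensity_ofReal hgi.2
  refine Measure.pi_eq fun s hs => ?_
  rw [withDensity_apply _ (MeasurableSet.univ_pi hs), Measure.restrict_pi_pi,
    ← ofReal_integral_eq_lintegral_ofReal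
      (Integrable.fintype_prod (f := fun _ => g) fun i => hgi.restrict)
      (Filter.Eventually.of_forall fun y => Finset.prod_nonneg fun i _ => hg0 _),
    integral_fintype_prod_eq_prod (fun _ => g),
    ENNReal.ofReal_prod_of_nonneg fun i _ => integral_nonneg hg0]
  refine Finset.prod_congr rfl fun i _ => ?_
  rw [withDensity_apply _ (hs i), ofReal_integral_eq_lintegral_ofReal hgi.restrict
    (Filter.Eventually.of_forall hg0)]

/-- The Haar measure on `ℝ` normalized so that `exp (-t²)` is a probability density. -/
noncomputable def gaussBase : Measure ℝ := ENNReal.ofReal (√Real.pi)⁻¹ • volume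

instance : gaussBase.IsAddHaarMeasure :=
  Measure.IsAddHaarMeasure.smul _ (by simp [Real.pi_pos]) ENNReal.ofReal_ne_top

theorem gaussianReal_half_eq :
    gaussianReal 0 (1 / 2) = gaussBase.withDensity fun t => ENNReal.ofReal (Real.exp (-t ^ 2)) := by
  rw [gaussianReal_of_var_ne_zero _ (by norm_num), gaussBase, withDensity_smul_measure,
    ← withDensity_smul _ (by fun_prop)]
  congr 1
  ext t
  have h1 : 2 * Real.pi * ((1 / 2 : NNReal) : ℝ) = Real.pi := by push_cast; ring
  have h2 : 2 * ((1 / 2 : NNReal) : ℝ) = 1 := by push_cast; ring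
  rw [gaussianPDF, gaussianPDFReal, h1, h2, ENNReal.ofReal_mul (by positivity)]
  simp

/-- The Haar measure on `ℂ^N` for which `exp (-‖u‖²)` is a probability density. -/
noncomputable def complexGaussBase (N : ℕ) : Measure (Fin N → ℂ) :=
  (Measure.pi fun _ : Fin N × Bool => gaussBase).map (realCoords N).symm

instance (N : ℕ) : (complexGaussBase N).IsAddHaarMeasure :=
  ContinuousLinearEquiv.isAddHaarMeasure_map _ _

theorem IsCircularGaussian.map_eq_withDensity_of_one {Ω : Type*} [MeasurableSpace Ω]
    {P : Measure Ω} [IsProbabilityMeasure P] {N : ℕ} {X : Ω → Fin N → ℂ}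
    (hX : IsCircularGaussian P X 1) :
    P.map X = (complexGaussBase N).withDensity
      fun u => ENNReal.ofReal (Real.exp (-∑ i, Complex.normSq (u i))) := by
  have hm : Measurable X := hX.measurable
  have h0 : P.map X = (P.map fun ω => realCoords N (X ω)).map (realCoords N).symm := by
    rw [Measure.map_map (by fun_prop) (by fun_prop)]
    congr 1
  have hi : Integrable (fun t : ℝ => Real.exp (-t ^ 2)) gaussBase := by
    refine Integrable.smul_measure ?_ ENNReal.ofReal_ne_top
    simpa using integrable_exp_neg_mul_sq one_pos
  rw [h0, hX.map_realCoords, gaussianReal_half_eq, pi_withDensity_ofReal _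
    (fun t => (Real.exp_pos _).le) hi, complexGaussBase,
    ← map_withDensity_comp _ (by fun_prop) (Measurable.ennreal_ofReal
      (Continuous.measurable (by fun_prop)))]
  congr 2
  ext y
  simp only [Function.comp_apply]
  rw [← sum_sq_realCoords, ← Real.exp_sum]
  simp

/-- The real determinant of a complex-linear map is the norm from ℂ to ℝ of its complex determinant;
this is the Jacobian of the whitening change of variables. -/
theorem det_restrictScalars_mulVecLin {N : ℕ} (A : Matrix (Fin N) (Fin N) ℂ) :
    LinearMap.det ((Matrix.mulVecLin A).restrictScalars ℝ) = Complex.normSq A.det := by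
  rw [LinearMap.det_restrictScalars, Algebra.norm_complex_apply, ← Matrix.toLin'_apply',
    LinearMap.det_toLin']

open scoped ComplexOrder MatrixOrder Matrix.Norms.L2Operator in
theorem Matrix.PosDef.exists_eq_mul_conjTranspose {N : ℕ} {W : Matrix (Fin N) (Fin N) ℂ}
    (hW : W.PosDef) : ∃ A : Matrix (Fin N) (Fin N) ℂ, IsUnit A.det ∧ W = A * Aᴴ := by
  obtain ⟨B, rfl⟩ := CStarAlgebra.nonneg_iff_eq_star_mul_self.mp hW.posSemidef.nonneg
  refine ⟨Bᴴ, ?_, by rw [Matrix.conjTranspose_conjTranspose]; rfl⟩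
  have h := hW.det_pos.ne'
  rw [Matrix.det_mul] at h
  exact (left_ne_zero_of_mul h).isUnit

/-- A function on a normed space that is bounded above, and bounded below by a quadratic. -/
def IsQuadraticallyBounded {E : Type*} [Norm E] (a : E → ℝ) : Prop :=
  ∃ K, ∀ y, -(K * (1 + ‖y‖ ^ 2)) ≤ a y ∧ a y ≤ K

open scoped ComplexOrder in
/-- The log-density of a circular Gaussian vector with invertible covariance. -/
theorem exists_logDensity {N : ℕ} {W : Matrix (Fin N) (Fin N) ℂ} (hW : W.PosDef) :
    ∃ a : (Fin N → ℂ) → ℝ, Measurable a ∧ IsQuadraticallyBounded a ∧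
      ∀ {Ω : Type*} [MeasurableSpace Ω] (P : Measure Ω) [IsProbabilityMeasure P]
        (X : Ω → Fin N → ℂ), IsCircularGaussian P X W →
        P.map X = (complexGaussBase N).withDensity (fun u => ENNReal.ofReal (Real.exp (a u))) ∧
        ∫ ω, a (X ω) ∂P = -Real.log W.det.re - N := by
  obtain ⟨A, hA, rfl⟩ := hW.exists_eq_mul_conjTranspose
  have hdet : (A * Aᴴ).det = (Complex.normSq A.det : ℂ) := by
    rw [Matrix.det_mul, Matrix.det_conjTranspose, RCLike.star_def, Complex.mul_conj]
  have hpos : 0 < Complex.normSq A.det := Complex.normSq_pos.2 hA.ne_zero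
  rw [hdet, Complex.ofReal_re]
  -- Since W = A Aᴴ, the quadratic form yᴴ W⁻¹ y equals ‖A⁻¹ y‖² in the Euclidean norm, and log det
  -- W = log |det A|².
  refine ⟨fun y => -Real.log (Complex.normSq A.det) - ∑ i, Complex.normSq ((A⁻¹ *ᵥ y) i),
    ?_, ?_, ?_⟩
  · refine Continuous.measurable ?_
    unfold Matrix.mulVec dotProduct
    fun_prop
  · let L : (Fin N → ℂ) →L[ℂ] (Fin N → ℂ) := LinearMap.toContinuousLinearMap A⁻¹.mulVecLin
    have hL : ∀ y, ∑ i, Complex.normSq ((A⁻¹ *ᵥ y) i) ≤ N * ‖L‖ ^ 2 * ‖y‖ ^ 2 := by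
      intro y
      have h1 : ∀ i ∈ Finset.univ, Complex.normSq ((A⁻¹ *ᵥ y) i) ≤ ‖L‖ ^ 2 * ‖y‖ ^ 2 := by
        intro i _
        rw [Complex.normSq_eq_norm_sq, ← mul_pow]
        exact pow_le_pow_left₀ (norm_nonneg _) ((norm_le_pi_norm (L y) i).trans (L.le_opNorm y)) 2
      simpa [mul_assoc] using Finset.sum_le_sum h1
    set l := Real.log (Complex.normSq A.det)
    -- One constant serves both bounds: |l| absorbs the log-determinant, N‖L‖² the quadratic form.
    refine ⟨|l| + N * ‖L‖ ^ 2, fun y => ⟨?_, ?_⟩⟩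
    · have h1 := hL y
      have h2 : 0 ≤ |l| * ‖y‖ ^ 2 := by positivity
      have h3 : 0 ≤ N * ‖L‖ ^ 2 := by positivity
      linarith [le_abs_self l]
    · have h1 : 0 ≤ ∑ i, Complex.normSq ((A⁻¹ *ᵥ y) i) :=
        Finset.sum_nonneg fun i _ => Complex.normSq_nonneg _
      have h3 : 0 ≤ N * ‖L‖ ^ 2 := by positivity
      linarith [neg_abs_le l]
  · intro Ω _ P _ X hX
    -- Whitening by `A⁻¹` reduces everything to unit covariance.
    have hU : IsCircularGaussian P (fun ω => A⁻¹ *ᵥ X ω) 1 := by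
      have h := hX.mulVec A⁻¹
      rwa [Matrix.mul_assoc, Matrix.mul_assoc, ← Matrix.conjTranspose_mul,
        Matrix.nonsing_inv_mul _ hA, Matrix.conjTranspose_one, Matrix.mul_one,
        Matrix.nonsing_inv_mul _ hA] at h
    constructor
    · set T := A.mulVecLin.restrictScalars ℝ
      have hT : Measurable T := (LinearMap.continuous_of_finiteDimensional T).measurable
      have hXU : P.map X = (P.map fun ω => A⁻¹ *ᵥ X ω).map T := by
        rw [Measure.map_map hT hU.measurable]
        congr 1
        ext ω : 1
        simp [T, Matrix.mulVec_mulVec, Matrix.mul_nonsing_inv _ hA]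
      have hg : Measurable fun y : Fin N → ℂ => ENNReal.ofReal (Real.exp
          (-∑ i, Complex.normSq ((A⁻¹ *ᵥ y) i))) := by
        refine Measurable.ennreal_ofReal (Continuous.measurable ?_)
        unfold Matrix.mulVec dotProduct
        fun_prop
      have hd : (fun u : Fin N → ℂ => ENNReal.ofReal (Real.exp (-∑ i, Complex.normSq (u i)))) =
          (fun y : Fin N → ℂ => ENNReal.ofReal (Real.exp
            (-∑ i, Complex.normSq ((A⁻¹ *ᵥ y) i)))) ∘ T := by
        ext u
        simp [T, Matrix.mulVec_mulVec, Matrix.nonsing_inv_mul _ hA]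
      have hdT : LinearMap.det T = Complex.normSq A.det := det_restrictScalars_mulVecLin A
      rw [hXU, hU.map_eq_withDensity_of_one, hd, map_withDensity_comp _ hT hg,
        Measure.map_linearMap_addHaar_eq_smul_addHaar _ (by rw [hdT]; exact hpos.ne'), hdT,
        withDensity_smul_measure, ← withDensity_smul _ hg]
      congr 1
      ext y
      beta_reduce
      rw [Pi.smul_apply, smul_eq_mul, ← ENNReal.ofReal_mul (abs_nonneg _), sub_eq_add_neg,
        Real.exp_add, Real.exp_neg (Real.log _), Real.exp_log hpos, abs_of_pos (inv_pos.2 hpos)]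
    · have hi : ∀ i, Integrable (fun ω => Complex.normSq ((A⁻¹ *ᵥ X ω) i)) P := by
        intro i
        have h := (hU.integrable_mul_star i i).re
        simpa [Complex.normSq_apply] using h
      -- Each whitened coordinate has second moment 1; the N of them produce the term -N.
      have h1 : ∀ i, ∫ ω, Complex.normSq ((A⁻¹ *ᵥ X ω) i) ∂P = 1 := by
        intro i
        have h := congrArg RCLike.re (hU.cov i i)
        rw [← integral_re (hU.integrable_mul_star i i)] at h
        simpa [Complex.normSq_apply] using h
      rw [integral_sub (integrable_const _) (integrable_finsetSum _ fun i _ => hi i),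
        integral_finsetSum _ fun i _ => hi i]
      simp [h1]

end Density

theorem ne_top_of_sum_eq_one {ι : Type*} [Fintype ι] {w : ι → ℝ≥0∞} (hw : ∑ c, w c = 1) (c : ι) :
    w c ≠ ∞ :=
  (ENNReal.lt_top_of_sum_ne_top (hw ▸ ENNReal.one_ne_top) (Finset.mem_univ c)).ne

/-! ### Relative entropy through log-densities, and additive channels. -/

section Information

variable {α E F Ω : Type*} [MeasurableSpace α] [MeasurableSpace E] [MeasurableSpace F]
  [MeasurableSpace Ω]

/-- The measure with density `exp a` with respect to `μ`. -/
noncomputable def expDensity (μ : Measure α) (a : α → ℝ) : Measure α :=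
  μ.withDensity fun y => ENNReal.ofReal (Real.exp (a y))

theorem expDensity_expDensity (μ : Measure α) {a b : α → ℝ} (ha : Measurable a)
    (hb : Measurable b) : expDensity (expDensity μ a) b = expDensity μ (fun y => a y + b y) := by
  rw [expDensity, expDensity, expDensity, ← withDensity_mul _ (by fun_prop) (by fun_prop)]
  congr 1
  ext y
  rw [Pi.mul_apply, ← ENNReal.ofReal_mul (Real.exp_pos _).le, Real.exp_add]

instance (μ : Measure α) [SigmaFinite μ] (a : α → ℝ) : SigmaFinite (expDensity μ a) :=
  SigmaFinite.withDensity_ofReal _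

/-- The Kullback-Leibler divergence of `exp(r) ν` from `ν`. -/
theorem klDiv_expDensity {ν : Measure α} [IsProbabilityMeasure ν] {r : α → ℝ} (hr : Measurable r)
    [IsProbabilityMeasure (expDensity ν r)] (hi : Integrable r (expDensity ν r)) :
    InformationTheory.klDiv (expDensity ν r) ν ≠ ∞ ∧
      (InformationTheory.klDiv (expDensity ν r) ν).toReal = ∫ y, r y ∂(expDensity ν r) := by
  have hac : expDensity ν r ≪ ν := withDensity_absolutelyContinuous _ _
  have hllr : llr (expDensity ν r) ν =ᵐ[expDensity ν r] r := by
    have h := Measure.rnDeriv_withDensity ν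
      (f := fun y => ENNReal.ofReal (Real.exp (r y))) (by fun_prop)
    filter_upwards [hac.ae_le h] with y hy
    rw [llr_def]
    change Real.log ((ν.withDensity _).rnDeriv ν y).toReal = r y
    rw [hy, ENNReal.toReal_ofReal (Real.exp_pos _).le, Real.log_exp]
  refine ⟨InformationTheory.klDiv_ne_top hac ((integrable_congr hllr).2 hi), ?_⟩
  rw [InformationTheory.toReal_klDiv_of_measure_eq hac (by simp), integral_congr_ae hllr]

/-- It suffices that `S` is a left inverse of `T`: it recovers from T y the point at which `a` is
evaluated. -/
theorem map_expDensity_equiv {β : Type*} [MeasurableSpace β] (μ : Measure α) {T : α → β}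
    {S : β → α} (hT : Measurable T) (hS : Measurable S) (hST : ∀ y, S (T y) = y) {a : α → ℝ}
    (ha : Measurable a) :
    (expDensity μ a).map T = expDensity (μ.map T) (fun y => a (S y)) := by
  rw [expDensity, expDensity, ← map_withDensity_comp _ hT (by fun_prop)]
  congr 2
  ext y
  simp [hST]

theorem prod_expDensity_right (μ : Measure E) [SFinite μ] (ν : Measure F) [SFinite ν]
    {a : F → ℝ} (ha : Measurable a) :
    μ.prod (expDensity ν a) = expDensity (μ.prod ν) (fun p => a p.2) := by
  rw [expDensity, expDensity, prod_withDensity_right (by fun_prop)]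

variable [AddCommGroup F] [MeasurableAdd₂ F] [MeasurableSub₂ F]

/-- The joint law of the input and the output of an additive channel with noise density `exp a` and
output density `exp b`. -/
theorem map_additiveChannel {P : Measure Ω} [IsProbabilityMeasure P] {lam : Measure F}
    [SigmaFinite lam] [lam.IsAddLeftInvariant] {X : Ω → E} {n z : Ω → F} {g : E → F}
    (hX : Measurable X) (hn : Measurable n) (hg : Measurable g) (hind : IndepFun X n P)
    (hz : ∀ ω, z ω = g (X ω) + n ω) {a b : F → ℝ} (ha : Measurable a) (hb : Measurable b)
    (hna : P.map n = expDensity lam a) (hzb : P.map z = expDensity lam b) :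
    P.map (fun ω => (X ω, z ω)) =
      expDensity ((P.map X).prod (P.map z)) (fun p => a (p.2 - g p.1) - b p.2) := by
  have hpX : IsProbabilityMeasure (P.map X) := Measure.isProbabilityMeasure_map hX.aemeasurable
  -- The shear (x, n) ↦ (x, g x + n) preserves P_X ⊗ lam by translation invariance on each fibre, so
  -- it merely transports the density of (X, n).
  have hshear : MeasurePreserving (fun p : E × F => (p.1, g p.1 + p.2)) ((P.map X).prod lam)
      ((P.map X).prod lam) :=
    (MeasurePreserving.id _).skew_product (g := fun x y => g x + y) (by fun_prop)
      (Filter.Eventually.of_forall fun x => (measurePreserving_add_left lam (g x)).map_eq)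
  have h1 : P.map (fun ω => (X ω, z ω)) =
      (P.map fun ω => (X ω, n ω)).map (fun p : E × F => (p.1, g p.1 + p.2)) := by
    rw [Measure.map_map hshear.measurable (by fun_prop)]
    congr 1
    ext ω : 1
    simp [hz]
  rw [h1, hind.map_prod_eq_prod_map_map hX.aemeasurable hn.aemeasurable, hna, hzb,
    prod_expDensity_right _ _ ha, prod_expDensity_right _ _ hb,
    expDensity_expDensity _ (by fun_prop) (by fun_prop),
    map_expDensity_equiv _ hshear.measurable (S := fun p => (p.1, p.2 - g p.1)) (by fun_prop)
      (by simp) (by fun_prop), hshear.map_eq]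
  congr 1
  ext p
  ring

/-- Along the channel z - g X = n, so the log-likelihood ratio of joint law to product law is a(n) -
b(z); its mean is the divergence. -/
theorem mutualInfo_additiveChannel {P : Measure Ω} [IsProbabilityMeasure P] {lam : Measure F}
    [SigmaFinite lam] [lam.IsAddLeftInvariant] {X : Ω → E} {n z : Ω → F} {g : E → F}
    (hX : Measurable X) (hn : Measurable n) (hg : Measurable g) (hind : IndepFun X n P)
    (hz : ∀ ω, z ω = g (X ω) + n ω) {a b : F → ℝ} (ha : Measurable a) (hb : Measurable b)
    (hna : P.map n = expDensity lam a) (hzb : P.map z = expDensity lam b)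
    (hia : Integrable (fun ω => a (n ω)) P) (hib : Integrable (fun ω => b (z ω)) P) :
    mutualInfo P X z ≠ ∞ ∧ (mutualInfo P X z).toReal =
      (∫ ω, a (n ω) ∂P - ∫ ω, b (z ω) ∂P) / Real.log 2 := by
  have hzm : Measurable z := by
    rw [funext hz]
    fun_prop
  have hJ := map_additiveChannel hX hn hg hind hz ha hb hna hzb
  have hr : Measurable fun p : E × F => a (p.2 - g p.1) - b p.2 := by fun_prop
  have hpX : IsProbabilityMeasure (P.map X) := Measure.isProbabilityMeasure_map hX.aemeasurable
  have hpz : IsProbabilityMeasure (P.map z) := Measure.isProbabilityMeasure_map hzm.aemeasurable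
  have hpJ : IsProbabilityMeasure (P.map fun ω => (X ω, z ω)) :=
    Measure.isProbabilityMeasure_map (by fun_prop)
  have hpJ' := hpJ
  rw [hJ] at hpJ'
  have e : (fun ω => a (z ω - g (X ω)) - b (z ω)) = fun ω => a (n ω) - b (z ω) := by
    ext ω
    simp [hz]
  have hi : Integrable (fun p : E × F => a (p.2 - g p.1) - b p.2)
      (P.map fun ω => (X ω, z ω)) := by
    rw [integrable_map_measure hr.aestronglyMeasurable (by fun_prop)]
    change Integrable (fun ω => a (z ω - g (X ω)) - b (z ω)) P
    rw [e]
    exact hia.sub hib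
  have key := klDiv_expDensity hr (hJ ▸ hi)
  rw [← hJ] at key
  have hlog : 0 < Real.log 2 := Real.log_pos one_lt_two
  refine ⟨ENNReal.div_ne_top key.1 (by simpa using hlog), ?_⟩
  rw [mutualInfo, ENNReal.toReal_div, key.2, ENNReal.toReal_ofReal hlog.le,
    integral_map (by fun_prop) hr.aestronglyMeasurable, e, integral_sub hia hib]

/-- If `exp Y` has expectation `m`, then the expectation of `Y` is at most `m - 1`. -/
theorem integral_le_of_lintegral_exp {P : Measure Ω} [IsProbabilityMeasure P] {Y : Ω → ℝ}
    (hY : Integrable Y P) (hfin : ∫⁻ ω, ENNReal.ofReal (Real.exp (Y ω)) ∂P ≠ ∞) :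
    ∫ ω, Y ω ∂P ≤ (∫⁻ ω, ENNReal.ofReal (Real.exp (Y ω)) ∂P).toReal - 1 := by
  have hm : AEStronglyMeasurable (fun ω => Real.exp (Y ω)) P :=
    Real.continuous_exp.comp_aestronglyMeasurable hY.1
  have hi : Integrable (fun ω => Real.exp (Y ω)) P :=
    (lintegral_ofReal_ne_top_iff_integrable hm
      (Filter.Eventually.of_forall fun ω => (Real.exp_pos _).le)).1 hfin
  rw [← integral_eq_lintegral_of_nonneg_ae
    (Filter.Eventually.of_forall fun ω => (Real.exp_pos _).le) hm]
  have h : ∫ ω, Y ω ∂P ≤ ∫ ω, (Real.exp (Y ω) - 1) ∂P :=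
    integral_mono hY (hi.sub (integrable_const _)) fun ω => by
      linarith [Real.add_one_le_exp (Y ω)]
  simpa [integral_sub hi (integrable_const _)] using h

/-- Apply exp t ≥ 1 + t to t = r' - r and note that exp(r' - r) · exp r = exp r'. The total mass of
exp(r') is left free: in the mixture argument the individual masses need not be 1, only their
weighted average. -/
theorem integral_expDensity_le {μ : Measure α} {r r' : α → ℝ} (hr : Measurable r)
    (hr' : Measurable r') [IsProbabilityMeasure (expDensity μ r)]
    (hi : Integrable r (expDensity μ r)) (hi' : Integrable r' (expDensity μ r))
    (hfin : ∫⁻ y, ENNReal.ofReal (Real.exp (r' y)) ∂μ ≠ ∞) :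
    ∫ y, r' y ∂(expDensity μ r) ≤ ∫ y, r y ∂(expDensity μ r) +
      (∫⁻ y, ENNReal.ofReal (Real.exp (r' y)) ∂μ).toReal - 1 := by
  have e : ∫⁻ y, ENNReal.ofReal (Real.exp (r' y - r y)) ∂(expDensity μ r) =
      ∫⁻ y, ENNReal.ofReal (Real.exp (r' y)) ∂μ := by
    rw [expDensity, lintegral_withDensity_eq_lintegral_mul _ (by fun_prop) (by fun_prop)]
    refine lintegral_congr fun y => ?_
    rw [Pi.mul_apply, ← ENNReal.ofReal_mul (Real.exp_pos _).le, ← Real.exp_add]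
    congr 2
    ring
  have h := integral_le_of_lintegral_exp (hi'.sub hi) (by simpa [e] using hfin)
  simp only [Pi.sub_apply] at h
  rw [e, integral_sub hi' hi] at h
  linarith

/-- Gibbs' inequality for log-densities. -/
theorem integral_logDensity_le {μ : Measure α} {r r' : α → ℝ} (hr : Measurable r)
    (hr' : Measurable r') [IsProbabilityMeasure (expDensity μ r)]
    [IsProbabilityMeasure (expDensity μ r')]
    (hi : Integrable r (expDensity μ r)) (hi' : Integrable r' (expDensity μ r)) :
    ∫ y, r' y ∂(expDensity μ r) ≤ ∫ y, r y ∂(expDensity μ r) := by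
  have h1 : ∫⁻ y, ENNReal.ofReal (Real.exp (r' y)) ∂μ = 1 := by
    rw [← setLIntegral_univ, ← withDensity_apply _ MeasurableSet.univ]
    exact measure_univ (μ := expDensity μ r')
  have h := integral_expDensity_le hr hr' hi hi' (by simp [h1])
  simpa [h1] using h

/-- Joint convexity of the relative entropy, in terms of log-densities. -/
theorem integral_logDensity_mixture_le {ι : Type*} [Fintype ι] {w : ι → ℝ≥0∞}
    (hw : ∑ c, w c = 1) {M : Measure α} {Mc : ι → Measure α} (hM : M = ∑ c, w c • Mc c)
    {r : α → ℝ} {rc : ι → α → ℝ} (hr : Measurable r) (hrc : ∀ c, Measurable (rc c))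
    [∀ c, IsProbabilityMeasure (expDensity (Mc c) (rc c))] [IsProbabilityMeasure (expDensity M r)]
    (hi : ∀ c, Integrable r (expDensity (Mc c) (rc c)))
    (hic : ∀ c, Integrable (rc c) (expDensity (Mc c) (rc c))) :
    ∑ c, (w c).toReal * ∫ y, r y ∂(expDensity (Mc c) (rc c)) ≤
      ∑ c, (w c).toReal * ∫ y, rc c y ∂(expDensity (Mc c) (rc c)) := by
  have hwt := ne_top_of_sum_eq_one hw
  set L : ι → ℝ≥0∞ := fun c => ∫⁻ y, ENNReal.ofReal (Real.exp (r y)) ∂(Mc c) with hL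
  -- The masses `L c` average to the mass of `expDensity M r`, so the corrections L c - 1 cancel
  -- after weighting.
  have h1 : ∑ c, w c * L c = 1 := by
    have h : ∫⁻ y, ENNReal.ofReal (Real.exp (r y)) ∂M = 1 := by
      rw [← setLIntegral_univ, ← withDensity_apply _ MeasurableSet.univ]
      exact measure_univ (μ := expDensity M r)
    rw [hM, lintegral_finsetSum_measure] at h
    simpa [lintegral_smul_measure] using h
  have hLt : ∀ c, w c ≠ 0 → L c ≠ ∞ := fun c hc h => by
    have := Finset.single_le_sum (f := fun c => w c * L c) (fun _ _ => zero_le)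
      (Finset.mem_univ c)
    simp only [h, h1, ENNReal.mul_top hc] at this
    simp at this
  have hterm : ∀ c, (w c).toReal * ∫ y, r y ∂(expDensity (Mc c) (rc c)) ≤
      (w c).toReal * ∫ y, rc c y ∂(expDensity (Mc c) (rc c)) +
        (w c * L c).toReal - (w c).toReal := by
    intro c
    rcases eq_or_ne (w c) 0 with h0 | h0
    · simp [h0]
    · have h := integral_expDensity_le (hrc c) hr (hic c) (hi c) (hLt c h0)
      have := mul_le_mul_of_nonneg_left h (ENNReal.toReal_nonneg (a := w c))
      rw [ENNReal.toReal_mul]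
      linarith
  have hs := Finset.sum_le_sum fun c (_ : c ∈ Finset.univ) => hterm c
  rw [Finset.sum_sub_distrib, Finset.sum_add_distrib, ← ENNReal.toReal_sum fun c _ => hwt c, hw,
    ← ENNReal.toReal_sum, h1] at hs
  · simpa using hs
  · intro c _
    rcases eq_or_ne (w c) 0 with h0 | h0
    · simp [h0]
    · exact ENNReal.mul_ne_top (hwt c) (hLt c h0)

end Information

/-! ### Conditioning on an independent discrete state. -/

section Mixture

variable {Ω ι β γ : Type*} [MeasurableSpace Ω] [MeasurableSpace β] [MeasurableSpace γ]
  [MeasurableSpace ι] [MeasurableSingletonClass ι]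
  {P : Measure Ω} [IsProbabilityMeasure P] {ζ : Ω → ι} {Y : Ω → β}

/-- On the fibre the state can be frozen at `c`, and independence then removes the conditioning from
`Y`. -/
theorem map_cond_fiber (hζ : Measurable ζ) (hY : Measurable Y) (hind : IndepFun ζ Y P) {c : ι}
    (hc : P (ζ ⁻¹' {c}) ≠ 0) {G : ι → β → γ} (hG : ∀ c, Measurable (G c))
    (hF : Measurable fun ω => G (ζ ω) (Y ω)) :
    (ProbabilityTheory.cond P (ζ ⁻¹' {c})).map (fun ω => G (ζ ω) (Y ω)) =
      P.map (fun ω => G c (Y ω)) := by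
  ext A hA
  have hGY : Measurable fun ω => G c (Y ω) := (hG c).comp hY
  have e : ζ ⁻¹' {c} ∩ (fun ω => G (ζ ω) (Y ω)) ⁻¹' A = ζ ⁻¹' {c} ∩ Y ⁻¹' (G c ⁻¹' A) := by
    ext ω
    simp only [Set.mem_inter_iff, Set.mem_preimage, Set.mem_singleton_iff, and_congr_right_iff]
    rintro rfl
    rfl
  rw [Measure.map_apply hF hA, Measure.map_apply hGY hA,
    cond_apply (hζ (measurableSet_singleton c)), e,
    hind.measure_inter_preimage_eq_mul _ _ (measurableSet_singleton c) (hG c hA), ← mul_assoc,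
    ENNReal.inv_mul_cancel hc (measure_ne_top _ _), one_mul]
  rfl

variable [Fintype ι]

theorem sum_measure_fiber (hζ : Measurable ζ) : ∑ c, P (ζ ⁻¹' {c}) = 1 := by
  have h := sum_measure_preimage_singleton (μ := P) (f := ζ) Finset.univ
    fun c _ => hζ (measurableSet_singleton c)
  rw [h]
  simp

/-- The law of total probability for a function of independent variables, one of which is
discrete. -/
theorem map_eq_sum_fiber (hζ : Measurable ζ) (hY : Measurable Y) (hind : IndepFun ζ Y P)
    {G : ι → β → γ} (hG : ∀ c, Measurable (G c)) (hF : Measurable fun ω => G (ζ ω) (Y ω)) :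
    P.map (fun ω => G (ζ ω) (Y ω)) = ∑ c, P (ζ ⁻¹' {c}) • P.map (fun ω => G c (Y ω)) := by
  conv_lhs => rw [← sum_meas_smul_cond_fiber hζ P]
  rw [← Measure.mapₗ_apply_of_measurable hF, map_sum]
  refine Finset.sum_congr rfl fun c _ => ?_
  rw [Measure.mapₗ_apply_of_measurable hF, Measure.map_smul]
  rcases eq_or_ne (P (ζ ⁻¹' {c})) 0 with h0 | h0
  · simp [h0]
  · rw [map_cond_fiber hζ hY hind h0 hG hF]

theorem integral_eq_sum_fiber (hζ : Measurable ζ) (hY : Measurable Y) (hind : IndepFun ζ Y P)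
    {G : ι → β → ℝ} (hG : ∀ c, Measurable (G c)) (hF : Measurable fun ω => G (ζ ω) (Y ω))
    (hi : ∀ c, Integrable (fun ω => G c (Y ω)) P) :
    Integrable (fun ω => G (ζ ω) (Y ω)) P ∧
      ∫ ω, G (ζ ω) (Y ω) ∂P = ∑ c, P.real (ζ ⁻¹' {c}) * ∫ ω, G c (Y ω) ∂P := by
  -- Expectations are read as integrals of the identity against laws on ℝ, so that total probability
  -- for measures applies.
  have hid : ∀ c, Integrable (fun t : ℝ => t) (P.map fun ω => G c (Y ω)) := fun c =>
    (integrable_map_measure (by fun_prop) ((hG c).comp hY).aemeasurable).2 (hi c)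
  have hs : ∀ c ∈ Finset.univ, Integrable (fun t : ℝ => t)
      (P (ζ ⁻¹' {c}) • P.map fun ω => G c (Y ω)) := fun c _ =>
    (hid c).smul_measure (measure_ne_top _ _)
  have hsum := integrable_finsetSum_measure.2 hs
  rw [← map_eq_sum_fiber hζ hY hind hG hF] at hsum
  refine ⟨(integrable_map_measure (by fun_prop) hF.aemeasurable).1 hsum, ?_⟩
  rw [← integral_map (f := fun t : ℝ => t) hF.aemeasurable (by fun_prop),
    map_eq_sum_fiber hζ hY hind hG hF, integral_finsetSum_measure hs]
  refine Finset.sum_congr rfl fun c _ => ?_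
  rw [integral_smul_measure, integral_map (by exact ((hG c).comp hY).aemeasurable) (by fun_prop)]
  rfl

end Mixture

/-! ### Log-densities of finite mixtures. -/

section LogMix

variable {ι : Type*} [Fintype ι] {E : Type*} {w : ι → ℝ≥0∞} {a : ι → E → ℝ}

/-- The log-density of a mixture. -/
noncomputable def logMix {E : Type*} (w : ι → ℝ≥0∞) (a : ι → E → ℝ) (y : E) : ℝ :=
  Real.log (∑ c, (w c).toReal * Real.exp (a c y))

theorem exists_pos_of_sum_eq_one (hw : ∑ c, w c = 1) : ∃ c, 0 < (w c).toReal := by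
  by_contra! h
  have hwt := ne_top_of_sum_eq_one hw
  have h1 := congrArg ENNReal.toReal hw
  rw [ENNReal.toReal_sum fun c _ => hwt c, ENNReal.toReal_one] at h1
  linarith [Finset.sum_nonpos fun c (_ : c ∈ Finset.univ) => h c]

theorem exp_logMix (hw : ∑ c, w c = 1) (y : E) :
    Real.exp (logMix w a y) = ∑ c, (w c).toReal * Real.exp (a c y) := by
  obtain ⟨c, hc⟩ := exists_pos_of_sum_eq_one hw
  refine Real.exp_log (Finset.sum_pos' (fun c _ => by positivity) ⟨c, Finset.mem_univ c, ?_⟩)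
  positivity

/-- A sum of nonnegative terms dominates each term. This bound limits the cost of not knowing the
state to its entropy. -/
theorem le_logMix (c : ι) (hc : 0 < (w c).toReal) (y : E) :
    Real.log (w c).toReal + a c y ≤ logMix w a y := by
  have h : (w c).toReal * Real.exp (a c y) ≤ ∑ c, (w c).toReal * Real.exp (a c y) :=
    Finset.single_le_sum (f := fun c => (w c).toReal * Real.exp (a c y))
      (fun c _ => by positivity) (Finset.mem_univ c)
  have h2 := Real.log_le_log (by positivity) h
  rwa [Real.log_mul hc.ne' (Real.exp_pos _).ne', Real.log_exp] at h2

theorem expDensity_logMix [MeasurableSpace E] (lam : Measure E) (hw : ∑ c, w c = 1)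
    (ha : ∀ c, Measurable (a c)) :
    expDensity lam (logMix w a) = ∑ c, w c • expDensity lam (a c) := by
  have hwt := ne_top_of_sum_eq_one hw
  ext A hA
  simp only [expDensity, exp_logMix hw, Measure.coe_finsetSum, Finset.sum_apply, Measure.smul_apply,
    withDensity_apply _ hA, smul_eq_mul]
  simp_rw [ENNReal.ofReal_sum_of_nonneg
    fun c _ => mul_nonneg (ENNReal.toReal_nonneg (a := w c)) (Real.exp_pos (a c _)).le,
    ENNReal.ofReal_mul ENNReal.toReal_nonneg, ENNReal.ofReal_toReal (hwt _)]
  rw [lintegral_finsetSum _ fun c _ => by fun_prop]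
  refine Finset.sum_congr rfl fun c _ => ?_
  rw [lintegral_const_mul _ (by fun_prop)]

theorem IsQuadraticallyBounded.logMix [Norm E] (hw : ∑ c, w c = 1)
    (ha : ∀ c, IsQuadraticallyBounded (a c)) : IsQuadraticallyBounded (logMix w a) := by
  choose K hK using ha
  have hwt := ne_top_of_sum_eq_one hw
  obtain ⟨c, hc⟩ := exists_pos_of_sum_eq_one hw
  set l := Real.log (w c).toReal
  have hS : ∀ d, K d ≤ ∑ d, |K d| := fun d => (le_abs_self _).trans
    (Finset.single_le_sum (f := fun d => |K d|) (fun _ _ => abs_nonneg _) (Finset.mem_univ d))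
  -- The lower bound uses a single component of positive weight, whose log-weight costs |l|; the
  -- upper bound needs all the constants `K d`.
  refine ⟨|l| + ∑ d, |K d|, fun y => ⟨?_, ?_⟩⟩
  · have h1 := le_logMix (a := a) c hc y
    have h2 := (hK c y).1
    have h3 := mul_le_mul_of_nonneg_right (hS c) (by positivity : 0 ≤ 1 + ‖y‖ ^ 2)
    have h4 : 0 ≤ |l| * ‖y‖ ^ 2 := by positivity
    linarith [neg_abs_le l]
  · have h1 : _root_.logMix w a y ≤ ∑ d, |K d| := by
      rw [← Real.exp_le_exp, exp_logMix hw]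
      calc ∑ c, (w c).toReal * Real.exp (a c y)
          ≤ ∑ c, (w c).toReal * Real.exp (∑ d, |K d|) := by
            refine Finset.sum_le_sum fun c _ => mul_le_mul_of_nonneg_left ?_ ENNReal.toReal_nonneg
            exact Real.exp_le_exp.2 ((hK c y).2.trans (hS c))
        _ = Real.exp (∑ d, |K d|) := by
            rw [← Finset.sum_mul, ← ENNReal.toReal_sum fun c _ => hwt c, hw]
            simp
    linarith [abs_nonneg l]

theorem IsQuadraticallyBounded.integrable {F : Type*} [NormedAddCommGroup F] [MeasurableSpace F]
    {Ω : Type*} [MeasurableSpace Ω] {P : Measure Ω} [IsProbabilityMeasure P] {b : F → ℝ} (hb : IsQuadraticallyBounded b) (hbm : Measurable b) {X : Ω → F}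
    (hXm : Measurable X) (hX : MemLp X 2 P) : Integrable (fun ω => b (X ω)) P := by
  obtain ⟨K, hK⟩ := hb
  have h2 : Integrable (fun ω => |K| * (1 + ‖X ω‖ ^ 2)) P :=
    ((integrable_const 1).add (hX.integrable_norm_pow (by norm_num))).const_mul _
  refine h2.mono' (hbm.comp hXm).aestronglyMeasurable (Filter.Eventually.of_forall fun ω => ?_)
  have h1 := hK (X ω)
  have h3 := mul_le_mul_of_nonneg_right (le_abs_self K) (by positivity : 0 ≤ 1 + ‖X ω‖ ^ 2)
  have h4 : 0 ≤ |K| * ‖X ω‖ ^ 2 := by positivity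
  rw [Real.norm_eq_abs, abs_le]
  constructor <;> linarith [le_abs_self K]

end LogMix

/-! ### Additive channels with a random binary state. -/

section MixtureChannel

variable {Ω E F β : Type*} [MeasurableSpace Ω] [MeasurableSpace E] [MeasurableSpace β]
  [NormedAddCommGroup F] [MeasurableSpace F] [MeasurableAdd₂ F] [MeasurableSub₂ F]
  {P : Measure Ω} [IsProbabilityMeasure P] {lam : Measure F} [SigmaFinite lam]
  [lam.IsAddLeftInvariant] {x : Ω → E} {ζ : Ω → Bool} {Y : Ω → β} {g : E → F} {k : Bool → β → F}
  {a b : Bool → F → ℝ}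

/-- The binary entropy is at most log 2: this is the one-bit gap of the theorem. -/
theorem mul_log_add_mul_log_ge {p q : ℝ} (h : p + q = 1) :
    -Real.log 2 ≤ p * Real.log p + q * Real.log q := by
  obtain rfl : q = 1 - p := by linarith
  have := Real.binEntropy_le_log_two (p := p)
  rw [Real.binEntropy_eq_negMulLog_add_negMulLog_one_sub, Real.negMulLog, Real.negMulLog] at this
  linarith

/-- If `X` is independent of `(Z, Y)` and `Z` of `Y`, then `Z` is independent of `(X, Y)`. -/
theorem ProbabilityTheory.IndepFun.prodMk_left_comm {A B C : Type*} [MeasurableSpace A]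
    [MeasurableSpace B] [MeasurableSpace C] {X : Ω → A} {Z : Ω → B} {Y : Ω → C}
    (hXZY : IndepFun X (fun ω => (Z ω, Y ω)) P) (hX : Measurable X) (hZ : Measurable Z)
    (hY : Measurable Y) (hZY : IndepFun Z Y P) : IndepFun Z (fun ω => (X ω, Y ω)) P := by
  have i1 : IsProbabilityMeasure (P.map X) := Measure.isProbabilityMeasure_map hX.aemeasurable
  have i2 : IsProbabilityMeasure (P.map Y) := Measure.isProbabilityMeasure_map hY.aemeasurable
  have i3 : IsProbabilityMeasure (P.map Z) := Measure.isProbabilityMeasure_map hZ.aemeasurable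
  have hXY : IndepFun X Y P := hXZY.comp (ψ := Prod.snd) measurable_id measurable_snd
  -- Reassociating and swapping factors carries P_X ⊗ (P_Z ⊗ P_Y) to P_Z ⊗ (P_X ⊗ P_Y).
  have hT := ((measurePreserving_prodAssoc (P.map Z) (P.map X) (P.map Y)).comp
    ((Measure.measurePreserving_swap (μ := P.map X) (ν := P.map Z)).prod
      (MeasurePreserving.id (P.map Y)))).comp
    (measurePreserving_prodAssoc (P.map X) (P.map Z) (P.map Y)).symm
  rw [indepFun_iff_map_prod_eq_prod_map_map hZ.aemeasurable (by fun_prop),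
    hXY.map_prod_eq_prod_map_map hX.aemeasurable hY.aemeasurable, ← hT.map_eq,
    ← hZY.map_prod_eq_prod_map_map hZ.aemeasurable hY.aemeasurable,
    ← hXZY.map_prod_eq_prod_map_map hX.aemeasurable (by fun_prop),
    Measure.map_map hT.measurable (by fun_prop)]
  rfl

/-- An additive channel whose noise is `k ζ Y` for a binary state `ζ`: the mutual information
conditional on the state, and bounds for the unconditional mutual information. -/
theorem mutualInfo_mixtureChannel (hx : Measurable x) (hζ : Measurable ζ) (hY : Measurable Y)
    (hg : Measurable g) (hk : ∀ c, Measurable (k c))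
    (hind_x : IndepFun x (fun ω => (ζ ω, Y ω)) P) (hind_ζ : IndepFun ζ Y P)
    (ha : ∀ c, Measurable (a c)) (hb : ∀ c, Measurable (b c))
    (haq : ∀ c, IsQuadraticallyBounded (a c)) (hbq : ∀ c, IsQuadraticallyBounded (b c))
    (hn2 : ∀ c, MemLp (fun ω => k c (Y ω)) 2 P)
    (hz2 : ∀ c, MemLp (fun ω => g (x ω) + k c (Y ω)) 2 P)
    (hna : ∀ c, P.map (fun ω => k c (Y ω)) = expDensity lam (a c))
    (hzb : ∀ c, P.map (fun ω => g (x ω) + k c (Y ω)) = expDensity lam (b c))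
    {z : Ω → F} (hz : ∀ ω, z ω = g (x ω) + k (ζ ω) (Y ω)) {I : ℝ}
    (hI : I = ∑ c, P.real (ζ ⁻¹' {c}) *
      ((∫ ω, a c (k c (Y ω)) ∂P - ∫ ω, b c (g (x ω) + k c (Y ω)) ∂P) / Real.log 2)) :
    (condMutualInfo P x z ζ ≠ ∞ ∧ (condMutualInfo P x z ζ).toReal = I) ∧
      mutualInfo P x z ≠ ∞ ∧ I - 1 ≤ (mutualInfo P x z).toReal ∧
      (mutualInfo P x z).toReal ≤ I := by
  have hlog : 0 < Real.log 2 := Real.log_pos one_lt_two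
  have hkm : Measurable (Function.uncurry k) := measurable_from_prod_countable_right hk
  have hnm : Measurable fun ω => k (ζ ω) (Y ω) := hkm.comp (hζ.prodMk hY)
  have hncm : ∀ c, Measurable fun ω => k c (Y ω) := fun c => (hk c).comp hY
  obtain rfl : z = fun ω => g (x ω) + k (ζ ω) (Y ω) := funext hz
  have hzm : Measurable fun ω => g (x ω) + k (ζ ω) (Y ω) := (hg.comp hx).add hnm
  have hzcm : ∀ c, Measurable fun ω => g (x ω) + k c (Y ω) := fun c => (hg.comp hx).add (hncm c)
  have hxY : Measurable fun ω => (x ω, Y ω) := hx.prodMk hY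
  have hind_xY : IndepFun ζ (fun ω => (x ω, Y ω)) P := hind_x.prodMk_left_comm hx hζ hY hind_ζ
  have hind_n : IndepFun x (fun ω => k (ζ ω) (Y ω)) P :=
    hind_x.comp measurable_id hkm
  have hind_nc : ∀ c, IndepFun x (fun ω => k c (Y ω)) P := fun c =>
    hind_x.comp (ψ := fun q : Bool × β => k c q.2) measurable_id ((hk c).comp measurable_snd)
  set w : Bool → ℝ≥0∞ := fun c => P (ζ ⁻¹' {c}) with hw_def
  have hw : ∑ c, w c = 1 := sum_measure_fiber hζ
  have hia : ∀ c, Integrable (fun ω => a c (k c (Y ω))) P := fun c =>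
    (haq c).integrable (ha c) (hncm c) (hn2 c)
  have hib : ∀ c, Integrable (fun ω => b c (g (x ω) + k c (Y ω))) P := fun c =>
    (hbq c).integrable (hb c) (hzcm c) (hz2 c)
  -- the two states
  have hstate := fun c => mutualInfo_additiveChannel hx (hncm c) hg (hind_nc c)
    (fun ω => rfl) (ha c) (hb c) (hna c) (hzb c) (hia c) (hib c)
  -- The weight is kept because conditioning on a null state carries no information about the law.
  have hcond : ∀ c, w c * mutualInfo (ProbabilityTheory.cond P (ζ ⁻¹' {c})) x
      (fun ω => g (x ω) + k (ζ ω) (Y ω)) =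
      w c * mutualInfo P x (fun ω => g (x ω) + k c (Y ω)) := by
    intro c
    rcases eq_or_ne (w c) 0 with h0 | h0
    · simp [h0]
    · have h1 := map_cond_fiber hζ hxY hind_xY h0
        (G := fun c (q : E × β) => (q.1, g q.1 + k c q.2))
        (fun c => by have := hk c; fun_prop) (hx.prodMk hzm)
      have h2 := map_cond_fiber hζ hxY hind_xY h0
        (G := fun c (q : E × β) => g q.1 + k c q.2) (fun c => by have := hk c; fun_prop) hzm
      have h3 := map_cond_fiber hζ hxY hind_xY h0
        (G := fun c (q : E × β) => q.1) (fun c => measurable_fst) hx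
      rw [mutualInfo, mutualInfo, h1, h2, h3]
  have hcondI : condMutualInfo P x (fun ω => g (x ω) + k (ζ ω) (Y ω)) ζ =
      ∑ c, w c * mutualInfo P x (fun ω => g (x ω) + k c (Y ω)) :=
    Finset.sum_congr rfl fun c _ => hcond c
  have hfin : ∀ c, w c * mutualInfo P x (fun ω => g (x ω) + k c (Y ω)) ≠ ∞ := fun c =>
    ENNReal.mul_ne_top (measure_ne_top _ _) (hstate c).1
  have hz_mix : P.map (fun ω => g (x ω) + k (ζ ω) (Y ω)) =
      ∑ c, w c • P.map (fun ω => g (x ω) + k c (Y ω)) :=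
    map_eq_sum_fiber hζ hxY hind_xY (G := fun c (q : E × β) => g q.1 + k c q.2)
      (fun c => by have := hk c; fun_prop) hzm
  -- the mixture
  set p := logMix w a
  set q := logMix w b
  have hp : Measurable p := by
    unfold p logMix
    fun_prop
  have hq : Measurable q := by
    unfold q logMix
    fun_prop
  have hpn : P.map (fun ω => k (ζ ω) (Y ω)) = expDensity lam p := by
    rw [map_eq_sum_fiber hζ hY hind_ζ hk hnm, expDensity_logMix _ hw ha]
    simp only [hna, w]
  have hqz : P.map (fun ω => g (x ω) + k (ζ ω) (Y ω)) = expDensity lam q := by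
    rw [hz_mix, expDensity_logMix _ hw hb]
    simp only [hzb]
  have hip : ∀ c, Integrable (fun ω => p (k c (Y ω))) P := fun c =>
    (IsQuadraticallyBounded.logMix hw haq).integrable hp (hncm c) (hn2 c)
  have hiq : ∀ c, Integrable (fun ω => q (g (x ω) + k c (Y ω))) P := fun c =>
    (IsQuadraticallyBounded.logMix hw hbq).integrable hq (hzcm c) (hz2 c)
  have hPn := integral_eq_sum_fiber hζ hY hind_ζ (G := fun c y => p (k c y))
    (fun c => hp.comp (hk c)) (hp.comp hnm) hip
  have hQz := integral_eq_sum_fiber hζ hxY hind_xY (G := fun c y => q (g y.1 + k c y.2))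
    (fun c => by have := hk c; fun_prop) (hq.comp hzm) hiq
  have hmix := mutualInfo_additiveChannel hx hnm hg hind_n (fun ω => rfl) hp hq hpn hqz
    hPn.1 hQz.1
  -- the comparisons
  have hgibbs : ∀ c, ∫ ω, q (g (x ω) + k c (Y ω)) ∂P ≤ ∫ ω, b c (g (x ω) + k c (Y ω)) ∂P := by
    intro c
    have h1 : IsProbabilityMeasure (expDensity lam (b c)) :=
      hzb c ▸ Measure.isProbabilityMeasure_map (hzcm c).aemeasurable
    have h2 : IsProbabilityMeasure (expDensity lam q) :=
      hqz ▸ Measure.isProbabilityMeasure_map hzm.aemeasurable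
    have h := integral_logDensity_le (hb c) hq
      (by rw [← hzb c]; exact (integrable_map_measure (hb c).aestronglyMeasurable
        (hzcm c).aemeasurable).2 (hib c))
      (by rw [← hzb c]; exact (integrable_map_measure hq.aestronglyMeasurable
        (hzcm c).aemeasurable).2 (hiq c))
    rwa [← hzb c, integral_map (hzcm c).aemeasurable (hb c).aestronglyMeasurable,
      integral_map (hzcm c).aemeasurable hq.aestronglyMeasurable] at h
  -- With the weight as a factor, a null state, whose logarithm is a default value, contributes 0 ≤
  -- 0.
  have hnoise : ∀ c, (w c).toReal * (Real.log (w c).toReal + ∫ ω, a c (k c (Y ω)) ∂P) ≤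
      (w c).toReal * ∫ ω, p (k c (Y ω)) ∂P := by
    intro c
    rcases (ENNReal.toReal_nonneg (a := w c)).eq_or_lt with h0 | h0
    · simp [← h0]
    · refine mul_le_mul_of_nonneg_left ?_ h0.le
      have h := integral_mono ((integrable_const (Real.log (w c).toReal)).add (hia c)) (hip c)
        fun ω => le_logMix (a := a) c h0 (k c (Y ω))
      simp only [Pi.add_apply] at h
      rw [integral_add (integrable_const _) (hia c)] at h
      simpa using h
  -- The law of x does not depend on the state, so P_x ⊗ P_z is the mixture of the products P_x ⊗
  -- P_{z_c} and joint convexity applies.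
  have hconvex : ∑ c, (w c).toReal *
        (∫ ω, p (k c (Y ω)) ∂P - ∫ ω, q (g (x ω) + k c (Y ω)) ∂P) ≤
      ∑ c, (w c).toReal *
        (∫ ω, a c (k c (Y ω)) ∂P - ∫ ω, b c (g (x ω) + k c (Y ω)) ∂P) := by
    have i1 : IsProbabilityMeasure (P.map x) := Measure.isProbabilityMeasure_map hx.aemeasurable
    have hJc := fun c => map_additiveChannel hx (hncm c) hg (hind_nc c)
      (fun ω => rfl) (ha c) (hb c) (hna c) (hzb c)
    have hJ := map_additiveChannel hx hnm hg hind_n (fun ω => rfl) hp hq hpn hqz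
    have hxz : ∀ c, Measurable fun ω => (x ω, g (x ω) + k c (Y ω)) := fun c => hx.prodMk (hzcm c)
    have hrc : ∀ c, Measurable fun y : E × F => a c (y.2 - g y.1) - b c y.2 := fun c => by fun_prop
    have hr : Measurable fun y : E × F => p (y.2 - g y.1) - q y.2 := by fun_prop
    have i2 : ∀ c, IsProbabilityMeasure (expDensity ((P.map x).prod
        (P.map fun ω => g (x ω) + k c (Y ω))) fun y => a c (y.2 - g y.1) - b c y.2) := fun c =>
      hJc c ▸ Measure.isProbabilityMeasure_map (hxz c).aemeasurable
    have i3 : IsProbabilityMeasure (expDensity ((P.map x).prod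
        (P.map fun ω => g (x ω) + k (ζ ω) (Y ω))) fun y => p (y.2 - g y.1) - q y.2) :=
      hJ ▸ Measure.isProbabilityMeasure_map (hx.prodMk hzm).aemeasurable
    have hi : ∀ c, Integrable (fun y : E × F => p (y.2 - g y.1) - q y.2)
        (P.map fun ω => (x ω, g (x ω) + k c (Y ω))) := fun c => by
      rw [integrable_map_measure hr.aestronglyMeasurable (hxz c).aemeasurable]
      simp only [Function.comp_def, add_sub_cancel_left]
      exact (hip c).sub (hiq c)
    have hic : ∀ c, Integrable (fun y : E × F => a c (y.2 - g y.1) - b c y.2)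
        (P.map fun ω => (x ω, g (x ω) + k c (Y ω))) := fun c => by
      rw [integrable_map_measure (hrc c).aestronglyMeasurable (hxz c).aemeasurable]
      simp only [Function.comp_def, add_sub_cancel_left]
      exact (hia c).sub (hib c)
    have hM : (P.map x).prod (P.map fun ω => g (x ω) + k (ζ ω) (Y ω)) =
        ∑ c, w c • (P.map x).prod (P.map fun ω => g (x ω) + k c (Y ω)) := by
      rw [hz_mix, Fintype.sum_bool, Fintype.sum_bool, Measure.prod_add, Measure.prod_smul_right,
        Measure.prod_smul_right]
    have h := integral_logDensity_mixture_le hw hM hr hrc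
      (fun c => by rw [← hJc c]; exact hi c) (fun c => by rw [← hJc c]; exact hic c)
    simp_rw [← hJc] at h
    convert h using 4 with c _ c _
    · rw [integral_map (hxz c).aemeasurable hr.aestronglyMeasurable, ← integral_sub (hip c) (hiq c)]
      simp
    · rw [integral_map (hxz c).aemeasurable (hrc c).aestronglyMeasurable,
        ← integral_sub (hia c) (hib c)]
      simp
  have hwsum : (w true).toReal + (w false).toReal = 1 := by
    rw [← ENNReal.toReal_add (measure_ne_top _ _) (measure_ne_top _ _)]
    have := hw
    rw [Fintype.sum_bool] at this
    rw [this, ENNReal.toReal_one]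
  refine ⟨⟨?_, ?_⟩, hmix.1, ?_, ?_⟩
  · rw [hcondI]
    exact ENNReal.sum_ne_top.2 fun c _ => hfin c
  · rw [hcondI, ENNReal.toReal_sum fun c _ => hfin c, hI]
    refine Finset.sum_congr rfl fun c _ => ?_
    rw [ENNReal.toReal_mul, (hstate c).2]
    rfl
  · have hent := mul_log_add_mul_log_ge hwsum
    have e : I - 1 = (I * Real.log 2 - Real.log 2) / Real.log 2 := by field_simp
    rw [e, hmix.2]
    refine (div_le_div_iff_of_pos_right hlog).2 ?_
    rw [hPn.2, hQz.2, hI]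
    simp only [Fintype.sum_bool, Measure.real] at *
    have g1 := mul_le_mul_of_nonneg_left (hgibbs true) (ENNReal.toReal_nonneg (a := w true))
    have g2 := mul_le_mul_of_nonneg_left (hgibbs false) (ENNReal.toReal_nonneg (a := w false))
    have n1 := hnoise true
    have n2 := hnoise false
    simp only [hw_def] at *
    rw [add_mul, mul_assoc, mul_assoc, div_mul_cancel₀ _ hlog.ne', div_mul_cancel₀ _ hlog.ne']
    linarith
  · have e : I = I * Real.log 2 / Real.log 2 := by field_simp
    rw [e, hmix.2]
    refine (div_le_div_iff_of_pos_right hlog).2 ?_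
    rw [hPn.2, hQz.2, hI]
    simp only [Fintype.sum_bool, Measure.real, hw_def] at *
    rw [add_mul, mul_assoc, mul_assoc, div_mul_cancel₀ _ hlog.ne', div_mul_cancel₀ _ hlog.ne']
    linarith

end MixtureChannel

/-! ### Determinants of the noise and output covariances. -/

section Rates

variable {N : ℕ}

/-- The covariance of the noise: with interference for `c = true`, without it for `c = false`. -/
noncomputable def noiseCov (σ : ℝ) (s : Fin N → ℂ) (Rf : Matrix (Fin N) (Fin N) ℂ) (c : Bool) :
    Matrix (Fin N) (Fin N) ℂ :=
  (if c then Matrix.diagonal s * Rf * (Matrix.diagonal s)ᴴ else 0) + ((σ ^ 2 : ℝ) : ℂ) • 1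

/-- The covariance of the channel output in the given state. -/
noncomputable def outputCov (h : ℂ) (σ : ℝ) (s : Fin N → ℂ) (Rx Rf : Matrix (Fin N) (Fin N) ℂ)
    (c : Bool) : Matrix (Fin N) (Fin N) ℂ :=
  ((‖h‖ ^ 2 : ℝ) : ℂ) • Rx + noiseCov σ s Rf c

variable {h : ℂ} {σ : ℝ} {s : Fin N → ℂ} {Rx Rf : Matrix (Fin N) (Fin N) ℂ}

open scoped ComplexOrder in
theorem noiseCov_posDef (hσ : 0 < σ) (hRf : Rf.PosSemidef) (c : Bool) :
    (noiseCov σ s Rf c).PosDef := by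
  refine Matrix.PosDef.posSemidef_add ?_ (Matrix.PosDef.one.smul ?_)
  · cases c
    · exact Matrix.PosSemidef.zero
    · exact hRf.mul_mul_conjTranspose_same _
  · exact_mod_cast (by positivity : (0 : ℝ) < σ ^ 2)

open scoped ComplexOrder in
theorem outputCov_posDef (hσ : 0 < σ) (hRx : Rx.PosSemidef) (hRf : Rf.PosSemidef) (c : Bool) :
    (outputCov h σ s Rx Rf c).PosDef := by
  refine Matrix.PosDef.posSemidef_add (hRx.smul ?_) (noiseCov_posDef hσ hRf c)
  exact_mod_cast (by positivity : (0 : ℝ) ≤ ‖h‖ ^ 2)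

theorem det_outputCov_false (hσ : 0 < σ) :
    (outputCov h σ s Rx Rf false).det = (cleanMatrix h σ Rx).det * (noiseCov σ s Rf false).det := by
  have hσ' : (σ : ℂ) ≠ 0 := by exact_mod_cast hσ.ne'
  rw [← Matrix.det_mul]
  congr 1
  simp only [outputCov, noiseCov, cleanMatrix, Bool.false_eq_true, if_false, zero_add,
    Matrix.mul_smul, Matrix.mul_one, smul_add, smul_smul]
  rw [add_comm]
  congr 2
  push_cast
  field_simp

-- The noise covariance is σ² times `interferenceMatrix`, so right multiplication by it cancels the
-- inverse in `interferedMatrix`.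
open scoped ComplexOrder in
theorem det_outputCov_true (hσ : 0 < σ) (hRf : Rf.PosSemidef) :
    (outputCov h σ s Rx Rf true).det =
      (interferedMatrix h σ s Rx Rf).det * (noiseCov σ s Rf true).det := by
  have hσ' : (σ : ℂ) ≠ 0 := by exact_mod_cast hσ.ne'
  have hu : IsUnit (interferenceMatrix σ s Rf).det :=
    (interferenceMatrix_posDef σ s hRf).det_pos.ne'.isUnit
  have hn : noiseCov σ s Rf true = ((σ ^ 2 : ℝ) : ℂ) • interferenceMatrix σ s Rf := by
    simp only [noiseCov, interferenceMatrix, if_true, smul_add, smul_smul]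
    rw [add_comm]
    congr 1
    rw [← Complex.ofReal_mul, mul_one_div_cancel (by positivity), Complex.ofReal_one, one_smul]
  rw [← Matrix.det_mul, outputCov, hn]
  congr 1
  rw [interferedMatrix, add_mul, one_mul, Matrix.mul_smul, Matrix.smul_mul, Matrix.mul_assoc,
    Matrix.nonsing_inv_mul _ hu, Matrix.mul_one, smul_smul, add_comm]
  congr 2
  push_cast
  field_simp

-- Both factors have positive real determinants, so taking real parts is multiplicative. For `B`
-- only the determinant is assumed positive, since `interferedMatrix` need not be Hermitian.
open scoped ComplexOrder in
theorem Matrix.PosDef.log_det_sub_log_det {A B C : Matrix (Fin N) (Fin N) ℂ} (hA : A.PosDef)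
    (hB : 0 < B.det) (hC : C.det = B.det * A.det) :
    Real.log C.det.re - Real.log A.det.re = Real.log B.det.re := by
  have hAd := RCLike.pos_iff.1 hA.det_pos
  have hBd := RCLike.pos_iff.1 hB
  simp only [RCLike.re_eq_complex_re, RCLike.im_eq_complex_im] at hAd hBd
  rw [hC, Complex.mul_re, hAd.2, mul_zero, sub_zero, Real.log_mul hBd.1.ne' hAd.1.ne',
    add_sub_cancel_right]

end Rates

/-! ### The compound rate as a mutual information. -/

theorem mainTheorem8 {Ω : Type*} [MeasurableSpace Ω] (P : Measure Ω) [IsProbabilityMeasure P]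
    (N : ℕ) (hN : 1 ≤ N)
    -- channel gain, radar code, noise standard deviation, covariances, interference probability
    (h : ℂ) (s : Fin N → ℂ) (σ : ℝ) (hσ : 0 < σ)
    (Rx Rf : Matrix (Fin N) (Fin N) ℂ) (α β : ℝ) (hβ : β = α)
    -- input, reflection coefficients, noise, interference indicator
    (x f v : Ω → Fin N → ℂ) (ζ : Ω → Bool)
    (hx : IsCircularGaussian P x Rx) (hf : IsCircularGaussian P f Rf)
    (hv : IsCircularGaussian P v (((σ ^ 2 : ℝ) : ℂ) • (1 : Matrix (Fin N) (Fin N) ℂ)))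
    (hζ : Measurable ζ) (hα : P.real (ζ ⁻¹' {true}) = α)
    -- mutual independence of `x`, `ζ`, `f`, `v`
    (hind_x : IndepFun x (fun ω => (ζ ω, f ω, v ω)) P)
    (hind_ζ : IndepFun ζ (fun ω => (f ω, v ω)) P)
    (hind_f : IndepFun f v P)
    -- the channel output
    (z : Ω → Fin N → ℂ) (hz : z = channelOutput h s x f v ζ) :
    (condMutualInfo P x z ζ ≠ ∞ ∧
      (N : ℝ) * compoundRate β h σ s Rx Rf = (condMutualInfo P x z ζ).toReal) ∧
    (mutualInfo P x z ≠ ∞ ∧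
      compoundRate β h σ s Rx Rf - 1 / (N : ℝ) ≤ 1 / (N : ℝ) * (mutualInfo P x z).toReal ∧
      1 / (N : ℝ) * (mutualInfo P x z).toReal ≤ compoundRate β h σ s Rx Rf) := by
  have hRx := hx.posSemidef
  have hRf := hf.posSemidef
  set k : Bool → (Fin N → ℂ) × (Fin N → ℂ) → Fin N → ℂ :=
    fun c q => (if c = true then Matrix.diagonal s *ᵥ q.1 else 0) + q.2 with hk_def
  have hk : ∀ c, Measurable (k c) := by
    intro c
    refine Continuous.measurable ?_
    cases c <;> simp only [hk_def, Bool.false_eq_true, if_true, if_false] <;> fun_prop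
  have hn : ∀ c, IsCircularGaussian P (fun ω => k c (f ω, v ω)) (noiseCov σ s Rf c) := by
    intro c
    cases c
    · simpa [hk_def, noiseCov] using hv
    · simpa [hk_def, noiseCov] using (hf.mulVec (Matrix.diagonal s)).add hv
        (hind_f.comp (φ := fun y => Matrix.diagonal s *ᵥ y)
          (Continuous.measurable (by fun_prop)) measurable_id)
  have hzc : ∀ c, IsCircularGaussian P (fun ω => h • x ω + k c (f ω, v ω))
      (outputCov h σ s Rx Rf c) := by
    intro c
    have h1 : IsCircularGaussian P (fun ω => h • x ω) (((‖h‖ ^ 2 : ℝ) : ℂ) • Rx) := by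
      -- Scaling by `h` is the matrix h • 1, which multiplies the covariance by h h̄ = ‖h‖².
      have h2 := hx.mulVec (h • (1 : Matrix (Fin N) (Fin N) ℂ))
      convert h2 using 1
      · ext ω : 1
        simp [Matrix.smul_mulVec]
      · simp [smul_smul, mul_comm _ h, Complex.mul_conj']
    exact h1.add (hn c) (hind_x.comp (φ := fun y => h • y)
      (ψ := fun q : Bool × (Fin N → ℂ) × (Fin N → ℂ) => k c q.2) (by fun_prop)
      ((hk c).comp measurable_snd))
  choose a ha haq haP using fun c => exists_logDensity (noiseCov_posDef (s := s) hσ hRf c)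
  choose b hb hbq hbP using fun c =>
    exists_logDensity (outputCov_posDef (h := h) (s := s) hσ hRx hRf c)
  have hNpos : (0 : ℝ) < N := by exact_mod_cast hN
  have hw : P.real (ζ ⁻¹' {false}) = 1 - α := by
    have := congrArg ENNReal.toReal (sum_measure_fiber (P := P) hζ)
    rw [Fintype.sum_bool, ENNReal.toReal_add (measure_ne_top _ _) (measure_ne_top _ _),
      ENNReal.toReal_one] at this
    rw [← hα, ← this]
    simp [Measure.real]
  -- The constants -N of the noise and output log-densities cancel in each state, leaving the
  -- log-ratio of determinants.
  have hrate : (N : ℝ) * compoundRate β h σ s Rx Rf = ∑ c, P.real (ζ ⁻¹' {c}) *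
      ((∫ ω, a c (k c (f ω, v ω)) ∂P - ∫ ω, b c (h • x ω + k c (f ω, v ω)) ∂P) /
        Real.log 2) := by
    have htrue := (noiseCov_posDef (s := s) hσ hRf true).log_det_sub_log_det
      (det_interferedMatrix_pos h σ s hRx hRf) (det_outputCov_true hσ hRf)
    have hfalse := (noiseCov_posDef (s := s) hσ hRf false).log_det_sub_log_det
      (det_cleanMatrix_pos h σ hRx) (det_outputCov_false hσ)
    rw [Fintype.sum_bool, hw, hα, (haP true P _ (hn true)).2, (haP false P _ (hn false)).2,
      (hbP true P _ (hzc true)).2, (hbP false P _ (hzc false)).2, compoundRate, rateInterfered,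
      rateClean, hβ, Real.logb, Real.logb, ← htrue, ← hfalse]
    field_simp
    ring
  have key := mutualInfo_mixtureChannel (g := fun y : Fin N → ℂ => h • y) hx.measurable hζ
    (hf.measurable.prodMk hv.measurable) (by fun_prop) hk hind_x hind_ζ ha hb haq hbq
    (fun c => (hn c).gaussian.memLp_two) (fun c => (hzc c).gaussian.memLp_two)
    (fun c => (haP c P _ (hn c)).1) (fun c => (hbP c P _ (hzc c)).1) (z := z)
    (fun ω => by rw [hz]; simp [channelOutput, hk_def, add_assoc]) hrate
  refine ⟨⟨key.1.1, key.1.2.symm⟩, key.2.1, ?_, ?_⟩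
  · rw [one_div_mul_eq_div, le_div_iff₀ hNpos, sub_mul, one_div_mul_cancel hNpos.ne', mul_comm]
    exact key.2.2.1
  · rw [one_div_mul_eq_div, div_le_iff₀ hNpos, mul_comm]
    exact key.2.2.2
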